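/- Let $\mathcal{O}$ be an integral domain and $n\ge 1$. Let $\mathrm{NH}_n(\mathcal{O})$ be the nilHecke algebra of type $A$: the unital associative $\mathcal{O}$-algebra with generators $x_1,\dots,x_n,\tau_1,\dots,\tau_{n-1}$ and defining relations $$\tau_r^2=0\ (1\le r<n),\qquad \tau_i\tau_j=\tau_j\tau_i\ (1\le i<j-1<n-1),\qquad \tau_a\tau_{a+1}\tau_a=\tau_{a+1}\tau_a\tau_{a+1}\ (1\le a<n-1),$$ $$x_jx_k=x_kx_j\ (1\le j,k\le n),\qquad \tau_ax_b=x_b\tau_a\ (1\le a<n,\ 1\le b\le n,\ b\notin\{a,a+1\}),$$ $$\tau_jx_{j+1}=x_j\tau_j+1,\qquad x_{j+1}\tau_j=\tau_jx_j+1\ (1\le j<n).$$ Let $[\mathrm{NH}_n(\mathcal{O}),\mathrm{NH}_n(\mathcal{O})]$ be the $\mathcal{O}$-span of all $ab-ba$ with $a,b\in\mathrm{NH}_n(\mathcal{O})$. For $1\le u\le v\le n$ put $$e_{[u,v]}:=(\tau_u\tau_{u+1}\cdots\tau_{v-1})(\tau_u\tau_{u+1}\cdots\tau_{v-2})\cdots(\tau_u)\;x_{u+1}x_{u+2}^2\cdots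 x_v^{v-u},$$ so that $e_{[u,u]}=1$. For $k\ge 0$ put $Z_n^{(k)}:=x_1^k\tau_1\tau_2\cdots\tau_{n-1}$. Products $\prod_{j=1}^d$ are taken in increasing order of $j$. Then: 1. If $n\ge 2$ and $0\le k<n-1$, then $Z_n^{(k)}\in[\mathrm{NH}_n(\mathcal{O}),\mathrm{NH}_n(\mathcal{O})]$. 2. If $k\ge n-1$, then $$Z_n^{(k)}\in\sum_{d\ge 1}\ \sum_{\substack{1=a_1<a_2<\cdots<a_d<a_{d+1}=n+1\\ l_1,\dots,l_d\ge 0,\ l_1+\cdots+l_d=k-(n-1)}}\mathcal{O}\prod_{j=1}^d\bigl(e_{[a_j,a_{j+1}-1]}\,x_{a_{j+1}-1}^{l_j}\bigr)+[\mathrm{NH}_n(\mathcal{O}),\mathrm{NH}_n(\mathcal{O})].$$ 3. For every $d\ge 1$ and all integers $1=a_1<a_2<\cdots<a_d<a_{d+1}=n+1$, $$\prod_{j=1}^d e_{[a_j,a_{j+1}-1]}\in\mathcal{O}\,e_{[1,n]}+[\mathrm{NH}_n(\mathcal{O}),\mathrm{NH}_n(\mathcal{O})].$$ In particular, $Z_n^{(n-1)}\in\mathcal{O}\,e_{[1,n]}+[\mathrm{NH}_n(\mathcal{O}),\mathrm{NH}_n(\mathcal{O})]$.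 -/

import Mathlib

/-- The generators `x₁, …, xₙ` and `τ₁, …, τₙ₋₁` of the nilHecke algebra. -/
inductive NilHeckeGen (n : ℕ) : Type
  | x (j : Set.Icc 1 n) : NilHeckeGen n
  | tau (r : Set.Ico 1 n) : NilHeckeGen n

/-- The free generator `x_j`, for `1 ≤ j ≤ n`. -/
def nilHeckeFreeX (O : Type*) [CommRing O] {n : ℕ} (j : Set.Icc 1 n) :
    FreeAlgebra O (NilHeckeGen n) :=
  FreeAlgebra.ι O (NilHeckeGen.x j)

/-- The free generator `τ_r`, for `1 ≤ r < n`. -/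
def nilHeckeFreeTau (O : Type*) [CommRing O] {n : ℕ} (r : Set.Ico 1 n) :
    FreeAlgebra O (NilHeckeGen n) :=
  FreeAlgebra.ι O (NilHeckeGen.tau r)

/-- The defining relations of the nilHecke algebra of type `A`. -/
inductive NilHeckeRel (O : Type*) [CommRing O] (n : ℕ) :
    FreeAlgebra O (NilHeckeGen n) → FreeAlgebra O (NilHeckeGen n) → Prop
  | tau_sq (r : Set.Ico 1 n) :
      NilHeckeRel O n (nilHeckeFreeTau O r * nilHeckeFreeTau O r) 0
  | tau_comm (i j : Set.Ico 1 n) (h : (i : ℕ) + 1 < (j : ℕ)) :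
      NilHeckeRel O n (nilHeckeFreeTau O i * nilHeckeFreeTau O j)
        (nilHeckeFreeTau O j * nilHeckeFreeTau O i)
  | braid (a b : Set.Ico 1 n) (h : (b : ℕ) = (a : ℕ) + 1) :
      NilHeckeRel O n (nilHeckeFreeTau O a * nilHeckeFreeTau O b * nilHeckeFreeTau O a)
        (nilHeckeFreeTau O b * nilHeckeFreeTau O a * nilHeckeFreeTau O b)
  | x_comm (j k : Set.Icc 1 n) :
      NilHeckeRel O n (nilHeckeFreeX O j * nilHeckeFreeX O k)
        (nilHeckeFreeX O k * nilHeckeFreeX O j)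
  | tau_x_comm (a : Set.Ico 1 n) (b : Set.Icc 1 n)
      (h₀ : (b : ℕ) ≠ (a : ℕ)) (h₁ : (b : ℕ) ≠ (a : ℕ) + 1) :
      NilHeckeRel O n (nilHeckeFreeTau O a * nilHeckeFreeX O b)
        (nilHeckeFreeX O b * nilHeckeFreeTau O a)
  | tau_x_succ (j : Set.Ico 1 n) (p q : Set.Icc 1 n)
      (hp : (p : ℕ) = (j : ℕ)) (hq : (q : ℕ) = (j : ℕ) + 1) :
      NilHeckeRel O n (nilHeckeFreeTau O j * nilHeckeFreeX O q)
        (nilHeckeFreeX O p * nilHeckeFreeTau O j + 1)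
  | x_succ_tau (j : Set.Ico 1 n) (p q : Set.Icc 1 n)
      (hp : (p : ℕ) = (j : ℕ)) (hq : (q : ℕ) = (j : ℕ) + 1) :
      NilHeckeRel O n (nilHeckeFreeX O q * nilHeckeFreeTau O j)
        (nilHeckeFreeTau O j * nilHeckeFreeX O p + 1)

/-- The nilHecke algebra `NH_n(O)` of type `A`, by generators and relations. -/
abbrev NilHecke (O : Type*) [CommRing O] (n : ℕ) : Type _ :=
  RingQuot (NilHeckeRel O n)

namespace NilHecke

/-- The element `x_j` of `NH_n(O)`, for `1 ≤ j ≤ n` (and `0` for `j` out of this range). -/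
noncomputable def x (O : Type*) [CommRing O] (n j : ℕ) : NilHecke O n :=
  if h : j ∈ Set.Icc 1 n then
    RingQuot.mkAlgHom O (NilHeckeRel O n) (nilHeckeFreeX O ⟨j, h⟩)
  else 0

/-- The element `τ_r` of `NH_n(O)`, for `1 ≤ r < n` (and `0` for `r` out of this range). -/
noncomputable def tau (O : Type*) [CommRing O] (n r : ℕ) : NilHecke O n :=
  if h : r ∈ Set.Ico 1 n then
    RingQuot.mkAlgHom O (NilHeckeRel O n) (nilHeckeFreeTau O ⟨r, h⟩)
  else 0

/-- The product `τ_u τ_{u+1} ⋯ τ_{u+m-1}` of `m` consecutive generators. -/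
noncomputable def tauRun (O : Type*) [CommRing O] (n u m : ℕ) : NilHecke O n :=
  ((List.range m).map fun i => tau O n (u + i)).prod

/-- `τ_{w[u,v]} = (τ_u ⋯ τ_{v-1}) (τ_u ⋯ τ_{v-2}) ⋯ (τ_u)`, where `w[u,v]` is the longest element
of the symmetric group on `{u, …, v}`; it is `1` for `u = v`. -/
noncomputable def tauLongest (O : Type*) [CommRing O] (n u v : ℕ) : NilHecke O n :=
  ((List.range (v - u)).map fun i => tauRun O n u (v - u - i)).prod

/-- `e_{[u,v]} = τ_{w[u,v]} x_{u+1} x_{u+2}^2 ⋯ x_v^{v-u}` for `1 ≤ u ≤ v ≤ n`;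
it is `1` for `u = v`. -/
noncomputable def e (O : Type*) [CommRing O] (n u v : ℕ) : NilHecke O n :=
  tauLongest O n u v * ((List.range (v - u)).map fun i => x O n (u + (i + 1)) ^ (i + 1)).prod

/-- `Z_n^{(k)} = x_1^k τ_1 τ_2 ⋯ τ_{n-1}`. -/
noncomputable def Z (O : Type*) [CommRing O] (n k : ℕ) : NilHecke O n :=
  x O n 1 ^ k * tauRun O n 1 (n - 1)

/-- The commutator subspace `[NH_n(O), NH_n(O)]`: the `O`-span of all `a b - b a`. -/
def commutatorSubspace (O : Type*) [CommRing O] (n : ℕ) : Submodule O (NilHecke O n) :=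
  Submodule.span O {z | ∃ a b : NilHecke O n, z = a * b - b * a}

/-- The sequences `1 = a_1 < a_2 < ⋯ < a_d < a_{d+1} = n + 1`, indexed from `0` to `d`. -/
def IsCutSequence (n d : ℕ) (a : Fin (d + 1) → ℕ) : Prop :=
  StrictMono a ∧ a 0 = 1 ∧ a (Fin.last d) = n + 1

/-- `∏_{j=1}^d e_{[a_j, a_{j+1}-1]} x_{a_{j+1}-1}^{l_j}`, with the factors in increasing order
of `j`. -/
noncomputable def blockProd (O : Type*) [CommRing O] (n d : ℕ) (a : Fin (d + 1) → ℕ)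
    (l : Fin d → ℕ) : NilHecke O n :=
  (List.ofFn fun j : Fin d =>
    e O n (a j.castSucc) (a j.succ - 1) * x O n (a j.succ - 1) ^ l j).prod

/-- `∏_{j=1}^d e_{[a_j, a_{j+1}-1]}`, with the factors in increasing order of `j`. -/
noncomputable def blockIdempotent (O : Type*) [CommRing O] (n d : ℕ) (a : Fin (d + 1) → ℕ) :
    NilHecke O n :=
  (List.ofFn fun j : Fin d => e O n (a j.castSucc) (a j.succ - 1)).prod

end NilHecke

/-! Grade by deg `x_j` = 1, deg `τ_r` = -1. A homogeneous element is a combination of normally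
ordered words of its degree, and `t = τ_{w[1,n]}` is killed on the left by every `τ_r`. So `z * t`,
hence `z * e_{[1,n]}`, vanishes when deg z < 0, and `z * e_{[1,n]}` is a multiple of `e_{[1,n]}`
when deg z = 0. Modulo commutators, the elements `z * e_{[1,n]}` suffice: cyclic rotation rewrites z
through products `y * t`, and `e_{[1,n]} * t = t` turns these into `(t * y) * e_{[1,n]}`, again of
the degree of z (`mem_of_forall_mul_e_mem`). So negative degrees die in the cocenter and degree 0 is
spanned by `e_{[1,n]}`; this settles claims 1, 3 and the last one by counting degrees. For claim 2,
the coefficients of `∏ (X - x_i)` are symmetric, hence central, so `x_1^k` and `x_n^k` obey the same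
linear recurrence. Comparing initial values gives `Z^{(k)} ≡ c • e_{[1,n]} x_n^{k-(n-1)}` for one
scalar c, which is already a one-block term. -/

/-! ### Polynomials with prescribed commuting roots. -/

section ProdXSubC

open Polynomial

variable {A : Type*} [Ring A]

/-- The polynomial `(X - y₁) ⋯ (X - y_m)` over a not necessarily commutative ring. -/
noncomputable def prodXSubC (y : ℕ → A) (m : ℕ) : A[X] :=
  ((List.range m).map fun i => X - C (y (i + 1))).prod

theorem commute_C_X_sub_C {a b : A} (h : Commute a b) : Commute (C a) (X - C b) :=
  (commute_X _).symm.sub_right (h.map (C : A →+* A[X]))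

theorem commute_X_sub_C_X_sub_C {a b : A} (h : Commute a b) :
    Commute (X - C a) (X - C b) :=
  ((commute_X _).sub_right (commute_X _)).sub_left (commute_C_X_sub_C h)

theorem commute_coeff_of_commute_C {a : A} {p : A[X]} (h : Commute (C a) p) (i : ℕ) :
    Commute (p.coeff i) a := by
  have := congrArg (fun p => coeff p i) h.eq
  simp only [coeff_C_mul, coeff_mul_C] at this
  exact this.symm

variable {y : ℕ → A}

theorem prodXSubC_succ (m : ℕ) : prodXSubC y (m + 1) = prodXSubC y m * (X - C (y (m + 1))) := by
  simp [prodXSubC, List.range_succ]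

theorem commute_C_prodXSubC {a : A} {m : ℕ} (h : ∀ i, 1 ≤ i → i ≤ m → Commute a (y i)) :
    Commute (C a) (prodXSubC y m) := by
  refine Commute.list_prod_right _ _ fun p hp => ?_
  obtain ⟨i, hi, rfl⟩ := List.mem_map.1 hp
  have := List.mem_range.1 hi
  exact commute_C_X_sub_C (h (i + 1) (by omega) (by omega))

theorem commute_C_mul_X_sub_C {t a b : A} (hadd : Commute t (a + b)) (hmul : Commute t (a * b)) :
    Commute (C t) ((X - C a) * (X - C b)) := by
  have h : (X - C a) * (X - C b) = X * X - C (a + b) * X + C (a * b) := by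
    rw [sub_mul, mul_sub, mul_sub, X_mul_C, C_add, C_mul, add_mul]
    abel
  rw [h]
  have hX := (commute_X (C t)).symm
  exact ((hX.mul_right hX).sub_right ((hadd.map (C : A →+* A[X])).mul_right hX)).add_right
    (hmul.map (C : A →+* A[X]))

/-- The two factors at r and r + 1 multiply to a quadratic whose coefficients are symmetric in `y
r`, `y (r + 1)`; t commutes with every other factor separately. -/
theorem commute_C_prodXSubC_of_swap {t : A} {r m : ℕ} (hr : 1 ≤ r) (hrm : r < m)
    (h : ∀ i, i ≠ r → i ≠ r + 1 → Commute t (y i)) (hadd : Commute t (y r + y (r + 1)))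
    (hmul : Commute t (y r * y (r + 1))) : Commute (C t) (prodXSubC y m) := by
  induction m with
  | zero => omega
  | succ m ih =>
    rcases Nat.lt_succ_iff_lt_or_eq.1 hrm with hlt | rfl
    · rw [prodXSubC_succ]
      exact (ih hlt).mul_right (commute_C_X_sub_C (h _ (by omega) (by omega)))
    · obtain ⟨r, rfl⟩ : ∃ k, r = k + 1 := ⟨r - 1, by omega⟩
      rw [prodXSubC_succ, prodXSubC_succ, mul_assoc]
      exact (commute_C_prodXSubC fun i _ hi => h i (by omega) (by omega)).mul_right
        (commute_C_mul_X_sub_C hadd hmul)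

theorem natDegree_prodXSubC_le (m : ℕ) : (prodXSubC y m).natDegree ≤ m := by
  induction m with
  | zero => simp [prodXSubC]
  | succ m ih =>
    rw [prodXSubC_succ]
    exact natDegree_mul_le.trans (add_le_add ih (natDegree_X_sub_C_le _))

theorem coeff_prodXSubC_self (m : ℕ) : (prodXSubC y m).coeff m = 1 := by
  induction m with
  | zero => simp [prodXSubC]
  | succ m ih =>
    rw [prodXSubC_succ, mul_sub, coeff_sub, coeff_mul_X, coeff_mul_C, ih,
      coeff_eq_zero_of_natDegree_lt (Nat.lt_succ_of_le (natDegree_prodXSubC_le m)), zero_mul,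
      sub_zero]

theorem eval_prodXSubC {j m : ℕ} (hj : 1 ≤ j) (hjm : j ≤ m)
    (hy : ∀ a b, Commute (y a) (y b)) : (prodXSubC y m).eval (y j) = 0 := by
  obtain ⟨q, hq⟩ : ∃ q, prodXSubC y m = q * (X - C (y j)) := by
    induction m with
    | zero => omega
    | succ m ih =>
      rcases hjm.lt_or_eq with h | rfl
      · obtain ⟨q, hq⟩ := ih (by omega)
        exact ⟨q * (X - C (y (m + 1))), by
          rw [prodXSubC_succ, hq, mul_assoc, mul_assoc, (commute_X_sub_C_X_sub_C (hy _ _)).eq]⟩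
      · exact ⟨_, prodXSubC_succ m⟩
  rw [hq, eval_mul_X_sub_C]

theorem sum_coeff_prodXSubC {j m : ℕ} (hj : 1 ≤ j) (hjm : j ≤ m)
    (hy : ∀ a b, Commute (y a) (y b)) (k : ℕ) :
    ∑ i ∈ Finset.range m, (prodXSubC y m).coeff i * y j ^ (i + k) + y j ^ (m + k) = 0 := by
  have h := congrArg (· * y j ^ k) (eval_prodXSubC hj hjm hy)
  simpa only [eval_eq_sum_range' (Nat.lt_succ_of_le (natDegree_prodXSubC_le m)),
    Finset.sum_range_succ, coeff_prodXSubC_self, one_mul, add_mul, Finset.sum_mul, mul_assoc,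
    ← pow_add, zero_mul] using h

end ProdXSubC

namespace NilHecke

/-! ### Relations, with out-of-range generators equal to 0. -/

section Relations

variable {O : Type*} [CommRing O] {n : ℕ}

theorem tau_of_not_mem {r : ℕ} (h : r ∉ Set.Ico 1 n) : tau O n r = 0 := dif_neg h

theorem x_of_not_mem {j : ℕ} (h : j ∉ Set.Icc 1 n) : x O n j = 0 := dif_neg h

theorem tau_mul_self (r : ℕ) : tau O n r * tau O n r = 0 := by
  by_cases h : r ∈ Set.Ico 1 n
  · simp only [tau, dif_pos h]
    rw [← map_mul, RingQuot.mkAlgHom_rel O (NilHeckeRel.tau_sq ⟨r, h⟩), map_zero]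
  · simp [tau_of_not_mem h]

theorem commute_tau_tau {i j : ℕ} (hij : i + 1 < j) : Commute (tau O n i) (tau O n j) := by
  by_cases hi : i ∈ Set.Ico 1 n
  · by_cases hj : j ∈ Set.Ico 1 n
    · simp only [Commute, SemiconjBy, tau, dif_pos hi, dif_pos hj]
      rw [← map_mul, RingQuot.mkAlgHom_rel O (NilHeckeRel.tau_comm ⟨i, hi⟩ ⟨j, hj⟩ hij), map_mul]
    · simp [tau_of_not_mem hj]
  · simp [tau_of_not_mem hi]

theorem tau_braid {a : ℕ} (ha : 1 ≤ a) (hn : a + 1 < n) :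
    tau O n a * tau O n (a + 1) * tau O n a
      = tau O n (a + 1) * tau O n a * tau O n (a + 1) := by
  have h₀ : a ∈ Set.Ico 1 n := ⟨ha, by omega⟩
  have h₁ : a + 1 ∈ Set.Ico 1 n := ⟨by omega, hn⟩
  simp only [tau, dif_pos h₀, dif_pos h₁]
  rw [← map_mul, ← map_mul, RingQuot.mkAlgHom_rel O (NilHeckeRel.braid ⟨a, h₀⟩ ⟨a + 1, h₁⟩ rfl),
    map_mul, map_mul]

theorem commute_x_x (j k : ℕ) : Commute (x O n j) (x O n k) := by
  by_cases hj : j ∈ Set.Icc 1 n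
  · by_cases hk : k ∈ Set.Icc 1 n
    · simp only [Commute, SemiconjBy, x, dif_pos hj, dif_pos hk]
      rw [← map_mul, RingQuot.mkAlgHom_rel O (NilHeckeRel.x_comm ⟨j, hj⟩ ⟨k, hk⟩), map_mul]
    · simp [x_of_not_mem hk]
  · simp [x_of_not_mem hj]

theorem commute_tau_x {a b : ℕ} (h₀ : b ≠ a) (h₁ : b ≠ a + 1) :
    Commute (tau O n a) (x O n b) := by
  by_cases ha : a ∈ Set.Ico 1 n
  · by_cases hb : b ∈ Set.Icc 1 n
    · simp only [Commute, SemiconjBy, tau, x, dif_pos ha, dif_pos hb]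
      rw [← map_mul, RingQuot.mkAlgHom_rel O (NilHeckeRel.tau_x_comm ⟨a, ha⟩ ⟨b, hb⟩ h₀ h₁),
        map_mul]
    · simp [x_of_not_mem hb]
  · simp [tau_of_not_mem ha]

theorem tau_mul_x_succ {j : ℕ} (h : j ∈ Set.Ico 1 n) :
    tau O n j * x O n (j + 1) = x O n j * tau O n j + 1 := by
  have hp : j ∈ Set.Icc 1 n := ⟨h.1, h.2.le⟩
  have hq : j + 1 ∈ Set.Icc 1 n := ⟨by omega, h.2⟩
  simp only [tau, x, dif_pos h, dif_pos hp, dif_pos hq]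
  rw [← map_mul,
    RingQuot.mkAlgHom_rel O (NilHeckeRel.tau_x_succ ⟨j, h⟩ ⟨j, hp⟩ ⟨j + 1, hq⟩ rfl rfl),
    map_add, map_mul, map_one]

theorem x_succ_mul_tau {j : ℕ} (h : j ∈ Set.Ico 1 n) :
    x O n (j + 1) * tau O n j = tau O n j * x O n j + 1 := by
  have hp : j ∈ Set.Icc 1 n := ⟨h.1, h.2.le⟩
  have hq : j + 1 ∈ Set.Icc 1 n := ⟨by omega, h.2⟩
  simp only [tau, x, dif_pos h, dif_pos hp, dif_pos hq]
  rw [← map_mul,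
    RingQuot.mkAlgHom_rel O (NilHeckeRel.x_succ_tau ⟨j, h⟩ ⟨j, hp⟩ ⟨j + 1, hq⟩ rfl rfl),
    map_add, map_mul, map_one]

theorem tau_mul_x {j : ℕ} (h : j ∈ Set.Ico 1 n) :
    tau O n j * x O n j = x O n (j + 1) * tau O n j - 1 := by
  rw [x_succ_mul_tau h, add_sub_cancel_right]

/-- An element commuting with all the generators is central. -/
theorem commute_of_generators {c : NilHecke O n} (hx : ∀ j, Commute c (x O n j))
    (ht : ∀ r, Commute c (tau O n r)) (z : NilHecke O n) : Commute c z := by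
  obtain ⟨w, rfl⟩ := RingQuot.mkAlgHom_surjective O (NilHeckeRel O n) z
  induction w using FreeAlgebra.induction with
  | grade0 a => rw [AlgHom.commutes]; exact (Algebra.commutes a c).symm
  | grade1 g =>
    cases g with
    | x j => simpa only [x, dif_pos j.2, nilHeckeFreeX] using hx j
    | tau r => simpa only [tau, dif_pos r.2, nilHeckeFreeTau] using ht r
  | mul a b ha hb => rw [map_mul]; exact ha.mul_right hb
  | add a b ha hb => rw [map_add]; exact ha.add_right hb

end Relations

/-! ### Degree and normal ordering. -/

section Degree

/-- The span of the normally ordered words (a word in the `x_j` followed by a word in the `τ_r`)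
of degree `d`, where each `x_j` has degree `1` and each `τ_r` has degree `-1`. -/
def orderedWords (O : Type*) [CommRing O] (n : ℕ) (d : ℤ) : Submodule O (NilHecke O n) :=
  Submodule.span O {z | ∃ L M : List ℕ, (L.length : ℤ) = M.length + d ∧
    z = (L.map (x O n)).prod * (M.map (tau O n)).prod}

/-- The elements whose left multiplication shifts the degree of normally ordered words by `d`. -/
def IsHomogeneous (O : Type*) [CommRing O] (n : ℕ) (d : ℤ) (z : NilHecke O n) : Prop :=
  ∀ c, ∀ y ∈ orderedWords O n c, z * y ∈ orderedWords O n (c + d)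

variable {O : Type*} [CommRing O] {n : ℕ}

theorem x_mul_mem_orderedWords (j : ℕ) {d : ℤ} {y : NilHecke O n} (hy : y ∈ orderedWords O n d) :
    x O n j * y ∈ orderedWords O n (d + 1) := by
  induction hy using Submodule.span_induction with
  | mem y h =>
    obtain ⟨L, M, hLM, rfl⟩ := h
    refine Submodule.subset_span ⟨j :: L, M, ?_, by simp [mul_assoc]⟩
    simp only [List.length_cons]; push_cast; omega
  | zero => simp
  | add a b _ _ ha hb => rw [mul_add]; exact add_mem ha hb
  | smul c a _ ha => rw [mul_smul_comm]; exact Submodule.smul_mem _ _ ha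

/-- Push `τ_r` to the right through the x's: each correction term ±1 loses one x and one `τ`, so the
degree is unchanged. -/
theorem tau_mul_word_mem (r : ℕ) (L M : List ℕ) :
    tau O n r * ((L.map (x O n)).prod * (M.map (tau O n)).prod)
      ∈ orderedWords O n ((L.length : ℤ) - M.length - 1) := by
  by_cases hr : r ∈ Set.Ico 1 n
  swap
  · simp [tau_of_not_mem hr]
  induction L with
  | nil =>
    refine Submodule.subset_span ⟨[], r :: M, ?_, by simp⟩
    simp
  | cons b L ih =>
    have key (j : ℕ) := x_mul_mem_orderedWords j ih
    have hw : (L.map (x O n)).prod * (M.map (tau O n)).prod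
        ∈ orderedWords O n (((b :: L).length : ℤ) - M.length - 1) :=
      Submodule.subset_span ⟨L, M, by rw [List.length_cons]; push_cast; ring, rfl⟩
    have hd : (L.length : ℤ) - M.length - 1 + 1 = ((b :: L).length : ℤ) - M.length - 1 := by
      simp only [List.length_cons]; push_cast; ring
    rw [hd] at key
    simp only [List.map_cons, List.prod_cons, mul_assoc]
    rw [← mul_assoc (tau O n r)]
    by_cases h₀ : b = r
    · subst h₀
      rw [tau_mul_x hr, sub_mul, one_mul, mul_assoc]
      exact sub_mem (key _) hw
    by_cases h₁ : b = r + 1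
    · subst h₁
      rw [tau_mul_x_succ hr, add_mul, one_mul, mul_assoc]
      exact add_mem (key _) hw
    rw [(commute_tau_x h₀ h₁).eq, mul_assoc]
    exact key _

theorem isHomogeneous_x (j : ℕ) : IsHomogeneous O n 1 (x O n j) :=
  fun _ _ hy => x_mul_mem_orderedWords j hy

theorem isHomogeneous_tau (r : ℕ) : IsHomogeneous O n (-1) (tau O n r) := by
  intro c y hy
  induction hy using Submodule.span_induction with
  | mem y h =>
    obtain ⟨L, M, hLM, rfl⟩ := h
    convert tau_mul_word_mem r L M using 2
    omega
  | zero => simp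
  | add a b _ _ ha hb => rw [mul_add]; exact add_mem ha hb
  | smul c a _ ha => rw [mul_smul_comm]; exact Submodule.smul_mem _ _ ha

theorem isHomogeneous_one : IsHomogeneous O n 0 1 := by
  intro c y hy; simpa using hy

theorem IsHomogeneous.mul {a b : ℤ} {y z : NilHecke O n} (hy : IsHomogeneous O n a y)
    (hz : IsHomogeneous O n b z) : IsHomogeneous O n (a + b) (y * z) := by
  intro c w hw
  rw [mul_assoc, add_comm a b, ← add_assoc]
  exact hy _ _ (hz _ _ hw)

theorem IsHomogeneous.pow {a : ℤ} {y : NilHecke O n} (hy : IsHomogeneous O n a y) (k : ℕ) :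
    IsHomogeneous O n (k * a) (y ^ k) := by
  induction k with
  | zero => simpa using isHomogeneous_one
  | succ k ih =>
    rw [pow_succ]
    convert ih.mul hy using 1
    push_cast; ring

theorem IsHomogeneous.mem_orderedWords {d : ℤ} {z : NilHecke O n} (hz : IsHomogeneous O n d z) :
    z ∈ orderedWords O n d := by
  have h1 : (1 : NilHecke O n) ∈ orderedWords O n 0 :=
    Submodule.subset_span ⟨[], [], by simp, by simp⟩
  simpa using hz 0 1 h1

theorem isHomogeneous_prod_range {f : ℕ → NilHecke O n} {a : ℕ → ℤ}
    (h : ∀ i, IsHomogeneous O n (a i) (f i)) (m : ℕ) :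
    IsHomogeneous O n (∑ i ∈ Finset.range m, a i) ((List.range m).map f).prod := by
  induction m with
  | zero => simpa using isHomogeneous_one
  | succ m ih =>
    rw [Finset.sum_range_succ, List.range_succ]
    simpa using ih.mul (h m)

theorem isHomogeneous_prod_ofFn {d : ℕ} {f : Fin d → NilHecke O n}
    (h : ∀ i, IsHomogeneous O n 0 (f i)) : IsHomogeneous O n 0 (List.ofFn f).prod := by
  induction d with
  | zero => simpa using isHomogeneous_one
  | succ d ih =>
    rw [List.ofFn_succ, List.prod_cons]
    simpa using (h 0).mul (ih fun i => h i.succ)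

theorem isHomogeneous_tauRun (u m : ℕ) : IsHomogeneous O n (-m) (tauRun O n u m) := by
  simpa [tauRun] using isHomogeneous_prod_range (fun i => isHomogeneous_tau (u + i)) m

theorem isHomogeneous_tauLongest (u v : ℕ) :
    IsHomogeneous O n (-∑ i ∈ Finset.range (v - u), ((i : ℤ) + 1)) (tauLongest O n u v) := by
  have := isHomogeneous_prod_range (fun i => isHomogeneous_tauRun (O := O) (n := n) u (v - u - i))
    (v - u)
  rw [tauLongest]
  convert this using 1
  rw [Finset.sum_neg_distrib, ← Finset.sum_range_reflect]
  congr 1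
  refine Finset.sum_congr rfl fun i hi => ?_
  have := Finset.mem_range.1 hi
  omega

theorem isHomogeneous_prod_x (u m : ℕ) :
    IsHomogeneous O n (∑ i ∈ Finset.range m, ((i : ℤ) + 1))
      ((List.range m).map fun i => x O n (u + (i + 1)) ^ (i + 1)).prod := by
  simpa using isHomogeneous_prod_range
    (fun i => (isHomogeneous_x (O := O) (n := n) (u + (i + 1))).pow (i + 1)) m

theorem isHomogeneous_e (u v : ℕ) : IsHomogeneous O n 0 (e O n u v) := by
  simpa [e] using (isHomogeneous_tauLongest u v).mul (isHomogeneous_prod_x u (v - u))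

theorem isHomogeneous_Z (hn : 1 ≤ n) (k : ℕ) :
    IsHomogeneous O n ((k : ℤ) - (n - 1)) (Z O n k) := by
  have := ((isHomogeneous_x (O := O) (n := n) 1).pow k).mul (isHomogeneous_tauRun 1 (n - 1))
  rw [Z]
  convert this using 1
  push_cast [hn]; ring

/-- Negative degree forces at least one `τ` in each word, and the rightmost one kills t. -/
theorem mul_eq_zero_of_mem_orderedWords {d : ℤ} (hd : d < 0) {t z : NilHecke O n}
    (ht : ∀ r, tau O n r * t = 0) (hz : z ∈ orderedWords O n d) : z * t = 0 := by
  induction hz using Submodule.span_induction with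
  | mem y h =>
    obtain ⟨L, M, hLM, rfl⟩ := h
    obtain rfl | ⟨M, r, rfl⟩ := M.eq_nil_or_concat'
    · simp at hLM; omega
    · simp [mul_assoc, ht]
  | zero => simp
  | add a b _ _ ha hb => rw [add_mul, ha, hb, add_zero]
  | smul c a _ ha => rw [smul_mul_assoc, ha, smul_zero]

theorem mul_mem_span_of_mem_orderedWords {t z : NilHecke O n}
    (ht : ∀ r, tau O n r * t = 0) (hz : z ∈ orderedWords O n 0) :
    z * t ∈ Submodule.span O {t} := by
  induction hz using Submodule.span_induction with
  | mem y h =>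
    obtain ⟨L, M, hLM, rfl⟩ := h
    obtain rfl | ⟨M, r, rfl⟩ := M.eq_nil_or_concat'
    · have : L = [] := by simpa using hLM
      subst this
      simp
    · simp [mul_assoc, ht]
  | zero => simp
  | add a b _ _ ha hb => rw [add_mul]; exact add_mem ha hb
  | smul c a _ ha => rw [smul_mul_assoc]; exact Submodule.smul_mem _ _ ha

end Degree

/-! ### The longest element and its idempotent. -/

section Longest

variable {O : Type*} [CommRing O] {n : ℕ}

@[simp] theorem tauRun_zero (u : ℕ) : tauRun O n u 0 = 1 := by simp [tauRun]

theorem tauRun_succ (u m : ℕ) : tauRun O n u (m + 1) = tauRun O n u m * tau O n (u + m) := by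
  simp [tauRun, List.range_succ]

theorem tauRun_succ' (u m : ℕ) :
    tauRun O n u (m + 1) = tau O n u * tauRun O n (u + 1) m := by
  simp [tauRun, List.range_succ_eq_map, Function.comp_def, add_assoc, add_comm 1]

theorem commute_tauRun {c : NilHecke O n} {u m : ℕ}
    (h : ∀ i, u ≤ i → i < u + m → Commute c (tau O n i)) : Commute c (tauRun O n u m) := by
  induction m with
  | zero => simp
  | succ m ih =>
    rw [tauRun_succ]
    exact (ih fun i h₁ h₂ => h i h₁ (by omega)).mul_right (h _ (by omega) (by omega))

theorem tauLongest_one_succ (m : ℕ) :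
    tauLongest O n 1 (m + 2) = tauRun O n 1 (m + 1) * tauLongest O n 1 (m + 1) := by
  simp [tauLongest, List.range_succ_eq_map, Function.comp_def]

theorem tau_mul_tauRun {r m : ℕ} (hr : 2 ≤ r) (hrm : r ≤ m) (hm : m < n) :
    tau O n r * tauRun O n 1 m = tauRun O n 1 m * tau O n (r - 1) := by
  induction m with
  | zero => omega
  | succ m ih =>
    rcases hrm.lt_or_eq with h | rfl
    · rw [tauRun_succ, ← mul_assoc, ih (by omega) (by omega), mul_assoc, mul_assoc]
      congr 1
      exact commute_tau_tau (by omega)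
    · obtain ⟨m, rfl⟩ : ∃ k, m = k + 1 := ⟨m - 1, by omega⟩
      have hc : Commute (tau O n (m + 1 + 1)) (tauRun O n 1 m) :=
        commute_tauRun fun i _ h => (commute_tau_tau (by omega)).symm
      have hb := tau_braid (O := O) (n := n) (a := m + 1) (by omega) hm
      simp only [tauRun_succ, Nat.add_sub_cancel, add_comm 1] at hb ⊢
      simp only [mul_assoc] at hb ⊢
      rw [← mul_assoc, hc.eq, mul_assoc, hb]

/-- `τ_1` squares to zero against the leading run; any other `τ_r` crosses that run as `τ_{r-1}` and
meets the shorter longest element. -/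
theorem tau_mul_tauLongest {r m : ℕ} (hr : 1 ≤ r) (hrm : r < m) (hm : m ≤ n) :
    tau O n r * tauLongest O n 1 m = 0 := by
  induction m generalizing r with
  | zero => omega
  | succ m ih =>
    obtain ⟨m, rfl⟩ : ∃ k, m = k + 1 := ⟨m - 1, by omega⟩
    rw [tauLongest_one_succ]
    rcases hr.lt_or_eq with h | rfl
    · rw [← mul_assoc, tau_mul_tauRun (by omega) (by omega) (by omega), mul_assoc,
        ih (by omega) (by omega) (by omega), mul_zero]
    · rw [tauRun_succ', ← mul_assoc, ← mul_assoc, tau_mul_self, zero_mul, zero_mul]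

theorem tau_mul_tauLongest_top (r : ℕ) : tau O n r * tauLongest O n 1 n = 0 := by
  by_cases hr : r ∈ Set.Ico 1 n
  · exact tau_mul_tauLongest hr.1 hr.2 le_rfl
  · simp [tau_of_not_mem hr]

theorem commute_tauLongest {c : NilHecke O n} {m : ℕ}
    (h : ∀ i, i < m → Commute c (tau O n i)) : Commute c (tauLongest O n 1 m) := by
  refine Commute.list_prod_right _ _ fun y hy => ?_
  obtain ⟨i, -, rfl⟩ := List.mem_map.1 hy
  exact commute_tauRun fun j _ hj => h j (by omega)

/-- Moving `x` leftwards through a run of `τ`s applied to an element killed by the lower `τ`s. -/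
theorem tauRun_mul_x_mul {r k : ℕ} (hr : 1 ≤ r) (hk : r + k < n) {z : NilHecke O n}
    (hz : ∀ i, i < r + k → tau O n i * z = 0) :
    tauRun O n r (k + 1) * (x O n (r + k + 1) * z)
      = x O n r * (tauRun O n r (k + 1) * z) + tauRun O n (r + 1) k * z := by
  induction k generalizing z with
  | zero =>
    simp only [tauRun_succ, tauRun_zero, one_mul, add_zero]
    rw [← mul_assoc, tau_mul_x_succ ⟨hr, hk⟩, add_mul, one_mul, mul_assoc]
  | succ k ih =>
    -- The `+ 1` from moving x past the last `τ` vanishes, as the remaining run ends in a `τ` that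
    -- kills z.
    have h₁ : tauRun O n r (k + 1) * z = 0 := by
      rw [tauRun_succ, mul_assoc, hz _ (by omega), mul_zero]
    have hz' : ∀ i, i < r + k → tau O n i * (tau O n (r + (k + 1)) * z) = 0 := fun i hi => by
      rw [← mul_assoc, (commute_tau_tau (by omega)).eq, mul_assoc, hz i (by omega), mul_zero]
    have h₂ : r + 1 + k = r + (k + 1) := by omega
    rw [tauRun_succ r (k + 1), tauRun_succ (r + 1) k, mul_assoc, ← mul_assoc (tau O n _),
      tau_mul_x_succ ⟨by omega, hk⟩, add_mul, one_mul, mul_add, h₁, add_zero, mul_assoc,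
      h₂, mul_assoc, mul_assoc]
    exact ih (by omega) hz'

/-- On z the run acts as iterated divided differences, which lower degree by k: powers below k give
0 and `x_{r+k}^k` gives 1. -/
theorem tauRun_mul_x_pow_mul {r k j : ℕ} (hr : 1 ≤ r) (hk : r + k ≤ n) (hj : j ≤ k)
    {z : NilHecke O n} (hz : ∀ i, i < r + k → tau O n i * z = 0) :
    tauRun O n r k * (x O n (r + k) ^ j * z) = if j = k then z else 0 := by
  induction k generalizing r j with
  | zero =>
    obtain rfl : j = 0 := by omega
    simp
  | succ k ih =>
    induction j with
    | zero => simp [tauRun_succ, mul_assoc, hz (r + k) (by omega)]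
    | succ j ihj =>
      have hz' : ∀ i, i < r + k → tau O n i * (x O n (r + k + 1) ^ j * z) = 0 := fun i hi => by
        rw [← mul_assoc, ((commute_tau_x (by omega) (by omega)).pow_right j).eq, mul_assoc,
          hz i (by omega), mul_zero]
      rw [pow_succ', mul_assoc]
      have h₁ := tauRun_mul_x_mul hr (by omega) hz'
      have h₂ := ihj (by omega)
      have h₃ := ih (r := r + 1) (j := j) (by omega) (by omega) (by omega)
        (fun i hi => hz i (by omega))
      rw [if_neg (by omega)] at h₂
      rw [show r + 1 + k = r + k + 1 by omega] at h₃
      rw [← add_assoc] at h₂ ⊢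
      rw [h₁, h₂, h₃, mul_zero, zero_add]
      simp

theorem e_one_succ (m : ℕ) :
    e O n 1 (m + 2) = tauRun O n 1 (m + 1) * (x O n (m + 2) ^ (m + 1) * e O n 1 (m + 1)) := by
  have hc : Commute (x O n (m + 2) ^ (m + 1)) (e O n 1 (m + 1)) := by
    refine Commute.mul_right (commute_tauLongest fun i hi => ?_)
      (Commute.list_prod_right _ _ fun y hy => ?_)
    · exact ((commute_tau_x (by omega) (by omega)).pow_right _).symm
    · obtain ⟨i, -, rfl⟩ := List.mem_map.1 hy
      exact (commute_x_x _ _).pow_pow _ _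
  rw [hc.eq, e, tauLongest_one_succ, e]
  simp [List.range_succ, mul_assoc, add_comm 1]

theorem e_mul {m : ℕ} (hm : m + 1 ≤ n) {z : NilHecke O n}
    (hz : ∀ i, i < m + 1 → tau O n i * z = 0) : e O n 1 (m + 1) * z = z := by
  induction m with
  | zero => simp [e, tauLongest]
  | succ m ih =>
    rw [e_one_succ, mul_assoc, mul_assoc, ih (by omega) fun i hi => hz i (by omega)]
    have := tauRun_mul_x_pow_mul (r := 1) (k := m + 1) (j := m + 1) le_rfl (by omega) le_rfl
      (z := z) fun i hi => hz i (by omega)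
    rwa [if_pos rfl, add_comm 1] at this

end Longest

/-! ### Reduction modulo commutators. -/

section Cocenter

variable {O : Type*} [CommRing O] {n : ℕ}

theorem sub_mem_commutatorSubspace (a b : NilHecke O n) :
    a * b - b * a ∈ commutatorSubspace O n := Submodule.subset_span ⟨a, b, rfl⟩

theorem mul_mem_commutatorSubspace {c z : NilHecke O n} (hc : ∀ y, Commute c y)
    (hz : z ∈ commutatorSubspace O n) : c * z ∈ commutatorSubspace O n := by
  induction hz using Submodule.span_induction with
  | mem y h =>
    obtain ⟨a, b, rfl⟩ := h
    convert sub_mem_commutatorSubspace (c * a) b using 1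
    rw [mul_sub, mul_assoc, ← mul_assoc b, ← (hc b).eq, mul_assoc]
  | zero => simp
  | add a b _ _ ha hb => rw [mul_add]; exact add_mem ha hb
  | smul c a _ ha => rw [mul_smul_comm]; exact Submodule.smul_mem _ _ ha

variable {W : Submodule O (NilHecke O n)}

theorem mem_of_swap_mem (hW : commutatorSubspace O n ≤ W) {a b : NilHecke O n}
    (h : b * a ∈ W) : a * b ∈ W := by
  simpa using add_mem (hW (sub_mem_commutatorSubspace a b)) h

/-- Shortens the run one `τ` at a time while the total degree of z times the run stays s. -/
theorem mul_tauRun_mul_mem (hW : commutatorSubspace O n ≤ W) {s : ℤ} {m k : ℕ}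
    (hm : m < n) (hk : k ≤ m)
    (h : ∀ z, IsHomogeneous O n (s + m) z → z * (tauRun O n 1 m * tauLongest O n 1 m) ∈ W)
    (z : NilHecke O n) (hz : IsHomogeneous O n (s + (m - k : ℕ)) z) :
    z * (tauRun O n (k + 1) (m - k) * tauLongest O n 1 m) ∈ W := by
  induction k generalizing z with
  | zero => simpa using h z (by simpa using hz)
  | succ k ih =>
    have hlow : ∀ i, i < m → tau O n i * tauLongest O n 1 m = 0 := fun i hi => by
      rcases Nat.eq_zero_or_pos i with rfl | hi'
      · rw [tau_of_not_mem (by simp), zero_mul]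
      · exact tau_mul_tauLongest hi' hi hm.le
    have key := tauRun_mul_x_mul (r := k + 1) (k := m - (k + 1)) (by omega) (by omega)
      (z := tauLongest O n 1 m) fun i hi => hlow i (by omega)
    have hc : Commute (x O n (m + 1)) (tauLongest O n 1 m) :=
      commute_tauLongest fun i hi => (commute_tau_x (by omega) (by omega)).symm
    rw [show k + 1 + (m - (k + 1)) + 1 = m + 1 by omega,
      show m - (k + 1) + 1 = m - k by omega, hc.eq] at key
    -- The shorter run is a difference of two terms with the longer run; in the first, the trailing
    -- `x_{m+1}` is rotated to the front and absorbed into z.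
    rw [← sub_eq_iff_eq_add'.2 key, mul_sub, ← mul_assoc (tauRun O n _ _), ← mul_assoc z (x O n _)]
    have hd : s + ((m - k : ℕ) : ℤ) = s + ((m - (k + 1) : ℕ) : ℤ) + 1 := by omega
    refine sub_mem ?_ (ih (by omega) _ ?_)
    · rw [← mul_assoc]
      refine mem_of_swap_mem hW ?_
      rw [← mul_assoc]
      refine ih (by omega) _ ?_
      rw [hd, add_comm _ (1 : ℤ)]
      exact (isHomogeneous_x _).mul hz
    · rw [hd]
      exact hz.mul (isHomogeneous_x _)

theorem mem_of_forall_mul_tauLongest_mem (hW : commutatorSubspace O n ≤ W) {m : ℕ} {s : ℤ}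
    (hm : m + 1 ≤ n)
    (h : ∀ z, IsHomogeneous O n (s + ∑ i ∈ Finset.range m, ((i : ℤ) + 1)) z →
      z * tauLongest O n 1 (m + 1) ∈ W)
    (z : NilHecke O n) (hz : IsHomogeneous O n s z) : z ∈ W := by
  induction m with
  | zero => simpa [tauLongest] using h z (by simpa using hz)
  | succ m ih =>
    refine ih (by omega) fun y hy => ?_
    have := mul_tauRun_mul_mem (m := m + 1) (k := m + 1) (z := y)
      (s := s + ∑ i ∈ Finset.range m, ((i : ℤ) + 1)) hW (by omega) le_rfl
    simp only [Nat.sub_self, tauRun_zero, one_mul, Nat.cast_zero, add_zero] at this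
    refine this (fun w hw => ?_) hy
    rw [← tauLongest_one_succ]
    refine h w ?_
    rw [Finset.sum_range_succ, ← add_assoc]
    exact_mod_cast hw

theorem IsHomogeneous.mem_of_forall_mul_e_mem (hn : 1 ≤ n) (hW : commutatorSubspace O n ≤ W)
    {d : ℤ} (h : ∀ z, IsHomogeneous O n d z → z * e O n 1 n ∈ W)
    {z : NilHecke O n} (hz : IsHomogeneous O n d z) : z ∈ W := by
  obtain ⟨m, rfl⟩ : ∃ m, n = m + 1 := ⟨n - 1, by omega⟩
  refine mem_of_forall_mul_tauLongest_mem hW le_rfl (fun y hy => ?_) z hz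
  have he : e O (m + 1) 1 (m + 1) * tauLongest O (m + 1) 1 (m + 1) = _ :=
    e_mul le_rfl fun i _ => tau_mul_tauLongest_top i
  -- Insert e before t, then rotate t to the front; its negative degree restores d.
  rw [← he, ← mul_assoc]
  refine mem_of_swap_mem hW ?_
  rw [← mul_assoc]
  refine h _ ?_
  simpa using (isHomogeneous_tauLongest 1 (m + 1)).mul hy

/-- Elements of negative degree are sums of commutators. -/
theorem IsHomogeneous.mem_commutatorSubspace (hn : 1 ≤ n) {d : ℤ} (hd : d < 0)
    {z : NilHecke O n} (hz : IsHomogeneous O n d z) : z ∈ commutatorSubspace O n := by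
  refine hz.mem_of_forall_mul_e_mem hn le_rfl fun y hy => ?_
  rw [e, ← mul_assoc,
    mul_eq_zero_of_mem_orderedWords hd tau_mul_tauLongest_top hy.mem_orderedWords, zero_mul]
  exact zero_mem _

/-- Modulo commutators, the elements of degree zero are multiples of `e_{[1,n]}`. -/
theorem IsHomogeneous.mem_span_e_sup_commutatorSubspace (hn : 1 ≤ n)
    {z : NilHecke O n} (hz : IsHomogeneous O n 0 z) :
    z ∈ Submodule.span O {e O n 1 n} ⊔ commutatorSubspace O n := by
  refine hz.mem_of_forall_mul_e_mem hn le_sup_right fun y hy => Submodule.mem_sup_left ?_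
  obtain ⟨c, hc⟩ := Submodule.mem_span_singleton.1
    (mul_mem_span_of_mem_orderedWords tau_mul_tauLongest_top hy.mem_orderedWords)
  rw [e, ← mul_assoc, ← hc, smul_mul_assoc]
  exact Submodule.smul_mem _ _ (Submodule.mem_span_singleton_self _)

end Cocenter

/-! ### Central recurrence and comparison of powers. -/

section Recurrence

variable {O : Type*} [CommRing O] {n : ℕ}

theorem commute_coeff_prodXSubC (i : ℕ) (z : NilHecke O n) :
    Commute ((prodXSubC (x O n) n).coeff i) z := by
  refine commute_of_generators (fun j => commute_coeff_of_commute_C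
    (commute_C_prodXSubC fun i _ _ => commute_x_x j i) i) (fun r => ?_) z
  by_cases hr : r ∈ Set.Ico 1 n
  · refine commute_coeff_of_commute_C (commute_C_prodXSubC_of_swap hr.1 hr.2
      (fun i h₀ h₁ => commute_tau_x h₀ h₁) ?_ ?_) i
    · rw [Commute, SemiconjBy, mul_add, add_mul, tau_mul_x hr, tau_mul_x_succ hr]
      abel
    · rw [Commute, SemiconjBy, (commute_x_x r (r + 1)).eq, ← mul_assoc, tau_mul_x_succ hr, add_mul,
        mul_assoc, tau_mul_x hr, ← (commute_x_x r (r + 1)).eq, mul_sub, mul_assoc]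
      simp
  · rw [tau_of_not_mem hr]; exact Commute.zero_right _

/-- The powers of all the `x_j` satisfy one linear recurrence with central coefficients. -/
theorem exists_central_recurrence (O : Type*) [CommRing O] (n : ℕ) :
    ∃ c : ℕ → NilHecke O n, (∀ i z, Commute (c i) z) ∧
      ∀ j k, 1 ≤ j → j ≤ n →
        ∑ i ∈ Finset.range n, c i * x O n j ^ (i + k) + x O n j ^ (n + k) = 0 :=
  ⟨_, commute_coeff_prodXSubC, fun _ k hj hjn =>
    sum_coeff_prodXSubC hj hjn (fun a b => commute_x_x a b) k⟩

/-- The scalar c is fixed by degree 0; the recurrence propagates it to all m. -/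
theorem Z_sub_smul_mem_commutatorSubspace (hn : 1 ≤ n) :
    ∃ c : O, ∀ m : ℕ,
      Z O n (m + (n - 1)) - c • (e O n 1 n * x O n n ^ m) ∈ commutatorSubspace O n := by
  have hZ := isHomogeneous_Z (O := O) hn (n - 1)
  rw [Nat.cast_sub hn, Nat.cast_one, sub_self] at hZ
  obtain ⟨_, hy, w, hw, hyw⟩ := Submodule.mem_sup.1 (hZ.mem_span_e_sup_commutatorSubspace hn)
  obtain ⟨c, rfl⟩ := Submodule.mem_span_singleton.1 hy
  obtain ⟨q, hq, hrec⟩ := exists_central_recurrence O n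
  -- p is `e_{[1,n]}` without its last factor `x_n^{n-1}`, so that `p * x_n^k` also makes sense for
  -- k < n - 1, where its degree is negative.
  obtain ⟨p, hpe, hp⟩ : ∃ p, p * x O n n ^ (n - 1) = e O n 1 n ∧
      IsHomogeneous O n (-(n - 1 : ℕ)) p := by
    obtain ⟨m, rfl⟩ : ∃ m, n = m + 1 := ⟨n - 1, by omega⟩
    rcases Nat.eq_zero_or_pos m with rfl | hm
    · exact ⟨1, by simp [e, tauLongest], by simpa using isHomogeneous_one⟩
    obtain ⟨m, rfl⟩ : ∃ k, m = k + 1 := ⟨m - 1, by omega⟩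
    refine ⟨tauLongest O (m + 2) 1 (m + 2) *
      ((List.range m).map fun i => x O (m + 2) (1 + (i + 1)) ^ (i + 1)).prod, ?_, ?_⟩
    · rw [e]
      simp [List.range_succ, mul_assoc, add_comm 1]
    · convert (isHomogeneous_tauLongest 1 (m + 2)).mul (isHomogeneous_prod_x 1 m) using 1
      rw [show m + 2 - 1 = m + 1 by omega, Finset.sum_range_succ]
      push_cast
      ring
  have key : ∀ k, Z O n k - c • (p * x O n n ^ k) ∈ commutatorSubspace O n := by
    intro k
    induction k using Nat.strong_induction_on with
    | _ k ih =>
      rcases lt_trichotomy k (n - 1) with hk | rfl | hk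
      · refine sub_mem ((isHomogeneous_Z hn k).mem_commutatorSubspace hn (by omega))
          (Submodule.smul_mem _ _ ((hp.mul ((isHomogeneous_x n).pow k)).mem_commutatorSubspace hn
            (by omega)))
      · rw [hpe, ← hyw, add_sub_cancel_left]
        exact hw
      · obtain ⟨k, rfl⟩ : ∃ l, k = n + l := ⟨k - n, by omega⟩
        -- Multiply the recurrence for `x_1` by the run on the right and that for `x_n` by p on the
        -- left; centrality of `q i` aligns them.
        have h : ∑ i ∈ Finset.range n, q i * (Z O n (i + k) - c • (p * x O n n ^ (i + k)))
            + (Z O n (n + k) - c • (p * x O n n ^ (n + k))) = 0 := by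
          have h₁ := congrArg (· * tauRun O n 1 (n - 1)) (hrec 1 k le_rfl hn)
          have h₂ := congrArg (fun z => c • (p * z)) (hrec n k hn le_rfl)
          simp only [add_mul, Finset.sum_mul, zero_mul, mul_add, Finset.mul_sum, smul_add,
            Finset.smul_sum, mul_zero, smul_zero, mul_assoc] at h₁ h₂
          have h₃ (i : ℕ) : q i * (c • (p * x O n n ^ (i + k)))
              = c • (p * (q i * x O n n ^ (i + k))) := by
            rw [mul_smul_comm, ← mul_assoc, (hq i p).eq, mul_assoc]
          simp only [mul_sub, Finset.sum_sub_distrib, h₃, Z]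
          rw [sub_add_sub_comm, h₁, h₂, sub_zero]
        refine (Submodule.add_mem_iff_right _ (sum_mem fun i hi => ?_)).1
          (h ▸ Submodule.zero_mem _)
        exact mul_mem_commutatorSubspace (hq i)
          (ih _ (by have := Finset.mem_range.1 hi; omega))
  refine ⟨c, fun m => ?_⟩
  rw [← hpe, mul_assoc, ← pow_add, add_comm (n - 1)]
  exact key _

end Recurrence

end NilHecke

theorem lemma3p9 (O : Type*) [CommRing O] [IsDomain O] (n : ℕ) (hn : 1 ≤ n) :
    (∀ k : ℕ, 2 ≤ n → k < n - 1 → NilHecke.Z O n k ∈ NilHecke.commutatorSubspace O n) ∧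
    (∀ k : ℕ, n - 1 ≤ k →
      NilHecke.Z O n k ∈
        Submodule.span O {z : NilHecke O n |
          ∃ (d : ℕ) (a : Fin (d + 1) → ℕ) (l : Fin d → ℕ),
            1 ≤ d ∧ NilHecke.IsCutSequence n d a ∧ ∑ j, l j = k - (n - 1) ∧
            z = NilHecke.blockProd O n d a l} ⊔
        NilHecke.commutatorSubspace O n) ∧
    (∀ (d : ℕ) (a : Fin (d + 1) → ℕ), 1 ≤ d → NilHecke.IsCutSequence n d a →
      NilHecke.blockIdempotent O n d a ∈
        Submodule.span O {NilHecke.e O n 1 n} ⊔ NilHecke.commutatorSubspace O n) ∧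
    NilHecke.Z O n (n - 1) ∈
      Submodule.span O {NilHecke.e O n 1 n} ⊔ NilHecke.commutatorSubspace O n := by
  refine ⟨fun k _ hk => ?_, fun k hk => ?_, fun d a _ _ => ?_, ?_⟩
  · exact (NilHecke.isHomogeneous_Z hn k).mem_commutatorSubspace hn (by omega)
  · obtain ⟨c, hc⟩ := NilHecke.Z_sub_smul_mem_commutatorSubspace (O := O) hn
    have h := hc (k - (n - 1))
    rw [Nat.sub_add_cancel hk] at h
    rw [← add_sub_cancel (c • (NilHecke.e O n 1 n * NilHecke.x O n n ^ (k - (n - 1))))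
      (NilHecke.Z O n k)]
    -- The single block [1, n], with the whole exponent on `x_n`, is enough.
    refine Submodule.add_mem_sup (Submodule.smul_mem _ _ (Submodule.subset_span
      ⟨1, ![1, n + 1], fun _ => k - (n - 1), le_rfl, ⟨?_, rfl, rfl⟩, by simp, ?_⟩)) h
    · rw [Fin.strictMono_iff_lt_succ]
      intro i
      fin_cases i
      simpa using Nat.lt_of_succ_le hn
    · simp [NilHecke.blockProd]
  · exact (NilHecke.isHomogeneous_prod_ofFn fun _ =>
      NilHecke.isHomogeneous_e _ _).mem_span_e_sup_commutatorSubspace hn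
  · have h := NilHecke.isHomogeneous_Z (O := O) hn (n - 1)
    rw [Nat.cast_sub hn, Nat.cast_one, sub_self] at h
    exact h.mem_span_e_sup_commutatorSubspace hn
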